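/- For $m\ge 1$ write a permutation of $[m]=\{1,\dots,m\}$ as a word $\sigma=\sigma_1\cdots\sigma_m$. A descent of $\sigma$ is a pair $(\sigma_i,\sigma_{i+1})$ with $\sigma_i>\sigma_{i+1}$; then $\sigma_i$ is called a descent top and $\sigma_{i+1}$ a descent bottom. A permutation $\sigma$ of $[2n]$ is an $\mathcal E$-permutation if every descent has an even top and an odd bottom, and for no $j\in\{1,\dots,n\}$ the entries $2j-1$ and $2j$ are simultaneously a descent bottom and a descent top of $\sigma$, respectively. Let $\overline{\mathcal X}_{2n}$ be the set of $\mathcal E$-permutations of $[2n]$. Let $\mathrm{des}\,\sigma$ be the number of descents of $\sigma$; let $\mathrm{lema}\,\sigma$ (resp. $\mathrm{loma}\,\sigma$) be the number of even (resp. odd) left-to-right maxima, i.e. of even (resp. odd) values $\sigma_i$ with $\sigma_j<\sigma_i$ for all $j<i$; let $\mathrm{les}\,\sigma$ be the number of pairs $(i,j)$ with $2\le i<j\le m$ and $\sigma_{i-1}>\sigma_j>\sigma_i$; and let $\mathrm{res}\,\sigma$ be the number of pairs $(i,j)$ with $1\le i<j\le m-1$ and $\sigma_j>\sigma_i>\sigma_{j+1}$.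 For $n\ge 1$ put $$[x,n]_{p,q}=x\,p^{n-1}+\sum_{i=1}^{n-1}p^{n-1-i}q^i,\qquad [n]_{p,q}=[1,n]_{p,q}.$$ Then, as formal power series in $x$ over $\mathbb Z[a,\bar a,p,q,t]$ (hence also for any values of $a,\bar a,p,q,t$ in a commutative ring), $$1+\sum_{n\ge 1}\ \sum_{\sigma\in\overline{\mathcal X}_{2n}}a^{\mathrm{lema}\,\sigma}\,\bar a^{\,\mathrm{loma}\,\sigma}\,p^{\mathrm{res}\,\sigma}\,q^{\mathrm{les}\,\sigma}\,t^{\mathrm{des}\,\sigma}\,x^n =\cfrac{1}{1-b_0x-\cfrac{\lambda_1x^2}{1-b_1x-\cfrac{\lambda_2x^2}{1-b_2x-\cdots}}}$$ where, for all $n\ge 1$, $$b_{n-1}=[a,n]_{p,q}\,[\bar a,n]_{p,q},\qquad \lambda_n=t\,[a,n]_{p,q}\,[a,n+1]_{p,q}\,[n]_{p,q}\,[\bar a,n+1]_{p,q}.$$ The infinite continued fraction denotes the coefficientwise limit of its finite truncations (each coefficient is eventually constant). -/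

import Mathlib

/-! Permutations of `[m] = {1, …, m}` are elements of `Equiv.Perm (Fin m)`; the letter in position
`i` of the word of `σ` is `letter σ i = σ i + 1`. -/

namespace EPermJFrac

/-- The letter (an element of `{1, …, m}`) of the word of `σ` at position `i`. -/
def letter {m : ℕ} (σ : Equiv.Perm (Fin m)) (i : Fin m) : ℕ := (σ i : ℕ) + 1

/-- `i`, `j` are consecutive positions and the letters there form a descent pair. -/
abbrev IsDescentAt {m : ℕ} (σ : Equiv.Perm (Fin m)) (i j : Fin m) : Prop :=
  (i : ℕ) + 1 = (j : ℕ) ∧ letter σ j < letter σ i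

/-- The number of descents. -/
def des {m : ℕ} (σ : Equiv.Perm (Fin m)) : ℕ :=
  (Finset.univ.filter fun i : Fin m => ∃ j : Fin m, IsDescentAt σ i j).card

/-- The letter `v` is a descent top of `σ`. -/
abbrev IsDescentTop {m : ℕ} (σ : Equiv.Perm (Fin m)) (v : ℕ) : Prop :=
  ∃ i j : Fin m, IsDescentAt σ i j ∧ letter σ i = v

/-- The letter `v` is a descent bottom of `σ`. -/
abbrev IsDescentBottom {m : ℕ} (σ : Equiv.Perm (Fin m)) (v : ℕ) : Prop :=
  ∃ i j : Fin m, IsDescentAt σ i j ∧ letter σ j = v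

/-- All descents have an even top and an odd bottom. -/
abbrev IsEvenOddDescentPerm {m : ℕ} (σ : Equiv.Perm (Fin m)) : Prop :=
  ∀ i j : Fin m, IsDescentAt σ i j → Even (letter σ i) ∧ Odd (letter σ j)

/-- An `𝓔`-permutation of `[2n]`: an even-odd descent permutation such that for no `j ∈ [n]` the
letters `2j-1` and `2j` are simultaneously a descent bottom and a descent top. -/
abbrev IsEPerm {n : ℕ} (σ : Equiv.Perm (Fin (2 * n))) : Prop :=
  IsEvenOddDescentPerm σ ∧
    ∀ j ∈ Finset.Icc 1 n, ¬ (IsDescentBottom σ (2 * j - 1) ∧ IsDescentTop σ (2 * j))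

/-- The letter at position `i` is a left-to-right maximum. -/
abbrev IsLRMax {m : ℕ} (σ : Equiv.Perm (Fin m)) (i : Fin m) : Prop :=
  ∀ j : Fin m, j < i → letter σ j < letter σ i

/-- The number of even left-to-right maxima. -/
def lema {m : ℕ} (σ : Equiv.Perm (Fin m)) : ℕ :=
  (Finset.univ.filter fun i : Fin m => IsLRMax σ i ∧ Even (letter σ i)).card

/-- The number of odd left-to-right maxima. -/
def loma {m : ℕ} (σ : Equiv.Perm (Fin m)) : ℕ :=
  (Finset.univ.filter fun i : Fin m => IsLRMax σ i ∧ Odd (letter σ i)).card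

/-- The number of pairs `(i, j)` with `2 ≤ i < j ≤ m` and `σ_{i-1} > σ_j > σ_i`;
`k` is the position `i - 1`. -/
def les {m : ℕ} (σ : Equiv.Perm (Fin m)) : ℕ :=
  (Finset.univ.filter fun x : Fin m × Fin m =>
    x.1 < x.2 ∧ ∃ k : Fin m, (k : ℕ) + 1 = (x.1 : ℕ) ∧
      letter σ x.2 < letter σ k ∧ letter σ x.1 < letter σ x.2).card

/-- The number of pairs `(i, j)` with `1 ≤ i < j ≤ m - 1` and `σ_j > σ_i > σ_{j+1}`;
`k` is the position `j + 1`. -/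
def res {m : ℕ} (σ : Equiv.Perm (Fin m)) : ℕ :=
  (Finset.univ.filter fun x : Fin m × Fin m =>
    x.1 < x.2 ∧ ∃ k : Fin m, (x.2 : ℕ) + 1 = (k : ℕ) ∧
      letter σ x.1 < letter σ x.2 ∧ letter σ k < letter σ x.1).card

section Ring

variable {R : Type*} [CommRing R]

/-- The sum over `𝓔`-permutations `σ` of `[2n]` of
`a ^ lema σ * abar ^ loma σ * p ^ res σ * q ^ les σ * t ^ des σ`. -/
def ePoly (a abar p q t : R) (n : ℕ) : R :=
  ∑ σ : Equiv.Perm (Fin (2 * n)) with IsEPerm σ,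
    a ^ lema σ * abar ^ loma σ * p ^ res σ * q ^ les σ * t ^ des σ

/-- `[x, n]_{p,q} = x p^{n-1} + ∑_{i=1}^{n-1} p^{n-1-i} q^i`, meant for `n ≥ 1`. -/
def pqBracket (p q x : R) (n : ℕ) : R :=
  x * p ^ (n - 1) + ∑ i ∈ Finset.Ico 1 n, p ^ (n - 1 - i) * q ^ i

/-- `jConv b lam k s` is the finite continued fraction with `k` levels
`1 / (1 - b_s x - lam_{s+1} x² / (1 - b_{s+1} x - ⋯ / (1 - b_{s+k-1} x)))`
as a formal power series in `x`. -/
noncomputable def jConv (b lam : ℕ → R) : ℕ → ℕ → PowerSeries R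
  | 0, _ => 0
  | k + 1, s =>
      PowerSeries.invOfUnit
        (1 - PowerSeries.C (b s) * PowerSeries.X
          - PowerSeries.C (lam (s + 1)) * PowerSeries.X ^ 2 * jConv b lam k (s + 1)) 1

/-- The inverse taken in `jConv` is a genuine one. -/
theorem jConv_succ_spec (b lam : ℕ → R) (k s : ℕ) :
    (1 - PowerSeries.C (b s) * PowerSeries.X
      - PowerSeries.C (lam (s + 1)) * PowerSeries.X ^ 2 * jConv b lam k (s + 1))
      * jConv b lam (k + 1) s = 1 := by
  rw [jConv]
  exact PowerSeries.mul_invOfUnit _ 1 (by simp)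

/-- `F` is the infinite J-fraction
`1 / (1 - b_0 x - lam_1 x² / (1 - b_1 x - lam_2 x² / (1 - b_2 x - ⋯)))`:
the convergents tend to `F` coefficientwise, each coefficient being eventually constant. -/
def IsJFraction (F : PowerSeries R) (b lam : ℕ → R) : Prop :=
  ∀ m : ℕ, ∀ᶠ k in Filter.atTop,
    PowerSeries.coeff m (jConv b lam k 0) = PowerSeries.coeff m F

end Ring

end EPermJFrac

/-!
Build the word of a permutation by inserting the letters `1, 2, …` in increasing order, keeping one
mark for each maximal run of letters that are still missing, and a final mark as a sentinel. The
next letter `v` replaces a mark `M` by `v M`, by `M v M` (`v` becomes a descent bottom) or by `v`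
alone (`v` becomes a descent top). When there are `h + 1` marks and the mark with exactly `i` marks
on its left is chosen, `v` is straddled by `i` descents on its left and by `h - i` on its right, and
it is a left-to-right maximum exactly when `i = 0`; summing over `i` gives a bracket
`[·, h + 1]_{p,q}`. In an `𝓔`-permutation the first kind of replacement is open to all letters, the
second only to odd and the third only to even ones, and `2j - 1`, `2j` may not use the second and
the third at once. So each such pair of letters changes the number of marks by at most one: it is a
step of a weighted Motzkin path, and these paths are enumerated by the J-fraction with the same
weights (Flajolet).
-/

namespace EPermJFrac

section MotzkinPaths

/-- The weighted number of Motzkin paths with `n` steps from height `0` to height `h`; a level step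
at height `i` has weight `b i`, a step from `i` to `i + 1` has weight `up i`, and a step from
`i + 1` to `i` has weight `down i`. -/
def motzkin {R : Type*} [Semiring R] (b up down : ℕ → R) : ℕ → ℕ → R
  | 0, h => if h = 0 then 1 else 0
  | n + 1, 0 => b 0 * motzkin b up down n 0 + down 0 * motzkin b up down n 1
  | n + 1, h + 1 => up h * motzkin b up down n h + b (h + 1) * motzkin b up down n (h + 1)
      + down (h + 1) * motzkin b up down n (h + 2)

variable {R : Type*} [CommRing R]

/-- The generating function, by length, of the Motzkin paths from height `0` to height `h` that stay
below height `K`, cut at the last of the steps from `i` to `i + 1`, for each `i < h`. -/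
noncomputable def motzkinSeries (b lam up : ℕ → R) (K : ℕ) : ℕ → PowerSeries R
  | 0 => jConv b lam K 0
  | h + 1 => PowerSeries.C (up h) * PowerSeries.X * jConv b lam (K - (h + 1)) (h + 1)
      * motzkinSeries b lam up K h

theorem motzkinSeries_zero_eq {b lam up down : ℕ → R} (hlam : ∀ h, lam (h + 1) = up h * down h)
    {K : ℕ} (hK : 0 < K) :
    motzkinSeries b lam up K 0 = 1 + (PowerSeries.C (b 0) * motzkinSeries b lam up K 0
      + PowerSeries.C (down 0) * motzkinSeries b lam up K 1) * PowerSeries.X := by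
  obtain ⟨k, rfl⟩ := Nat.exists_eq_add_of_lt hK
  have h := jConv_succ_spec b lam k 0
  simp only [motzkinSeries, zero_add, Nat.add_sub_cancel] at h ⊢
  have h1 := hlam 0
  simp only [zero_add] at h1
  rw [h1, map_mul] at h
  linear_combination h

theorem motzkinSeries_succ_eq {b lam up down : ℕ → R} (hlam : ∀ h, lam (h + 1) = up h * down h)
    {K h : ℕ} (hK : h + 1 < K) :
    motzkinSeries b lam up K (h + 1) = (PowerSeries.C (up h) * motzkinSeries b lam up K h
      + PowerSeries.C (b (h + 1)) * motzkinSeries b lam up K (h + 1)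
      + PowerSeries.C (down (h + 1)) * motzkinSeries b lam up K (h + 2)) * PowerSeries.X := by
  obtain ⟨k, rfl⟩ := Nat.exists_eq_add_of_lt hK
  have h0 := jConv_succ_spec b lam k (h + 1)
  rw [hlam (h + 1), map_mul] at h0
  have e1 : h + 1 + k + 1 - (h + 1) = k + 1 := by omega
  have e2 : h + 1 + k + 1 - (h + 1 + 1) = k := by omega
  simp only [motzkinSeries, e1, e2]
  linear_combination PowerSeries.C (up h) * PowerSeries.X
    * motzkinSeries b lam up (h + 1 + k + 1) h * h0

theorem coeff_motzkinSeries {b lam up down : ℕ → R} (hlam : ∀ h, lam (h + 1) = up h * down h)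
    {K : ℕ} (n h : ℕ) (hK : n + h < K) :
    PowerSeries.coeff n (motzkinSeries b lam up K h) = motzkin b up down n h := by
  induction n generalizing h with
  | zero =>
    cases h with
    | zero => rw [motzkinSeries_zero_eq hlam (by omega)]; simp [motzkin]
    | succ h => rw [motzkinSeries_succ_eq hlam (by omega)]; simp [motzkin]
  | succ n ih =>
    cases h with
    | zero =>
      rw [motzkinSeries_zero_eq hlam (by omega), map_add, PowerSeries.coeff_succ_mul_X]
      simp [motzkin, PowerSeries.coeff_one, ih 0 (by omega), ih 1 (by omega)]
    | succ h =>
      rw [motzkinSeries_succ_eq hlam (by omega), PowerSeries.coeff_succ_mul_X]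
      simp [motzkin, ih h (by omega), ih (h + 1) (by omega), ih (h + 2) (by omega)]

/-- Flajolet's theorem. -/
theorem isJFraction_of_coeff_eq_motzkin {b lam up down : ℕ → R}
    (hlam : ∀ h, lam (h + 1) = up h * down h) {F : PowerSeries R}
    (hF : ∀ n, PowerSeries.coeff n F = motzkin b up down n 0) : IsJFraction F b lam := by
  intro m
  filter_upwards [Filter.eventually_gt_atTop m] with k hk
  rw [hF, ← coeff_motzkinSeries hlam m 0 hk, motzkinSeries]

end MotzkinPaths

section AdjacentPairs

variable {A : Type*}

/-- The number of pairs of consecutive letters of a word that are related by `r`. -/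
def adjCount (r : A → A → Prop) [DecidableRel r] : List A → ℕ
  | [] => 0
  | [_] => 0
  | a :: b :: w => (if r a b then 1 else 0) + adjCount r (b :: w)

variable {r : A → A → Prop} [DecidableRel r]

theorem adjCount_append_cons {x : List A} {c : A} (hx : ∀ a ∈ x, ¬ r a c) (y : List A) :
    adjCount r (x ++ c :: y) = adjCount r x + adjCount r (c :: y) := by
  induction x with
  | nil => simp [adjCount]
  | cons a x ih =>
    cases x with
    | nil => simp [adjCount, hx a (by simp)]
    | cons b x =>
      simpa [adjCount, add_assoc] using ih fun a ha => hx a (List.mem_cons_of_mem _ ha)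

theorem adjCount_concat {x : List A} {c : A} (hx : ∀ a ∈ x, ¬ r a c) :
    adjCount r (x ++ [c]) = adjCount r x := by
  simpa [adjCount] using adjCount_append_cons hx []

theorem adjCount_eq_zero : ∀ {w : List A}, adjCount r w = 0 ↔ w.IsChain fun a b => ¬ r a b
  | [] => by simp [adjCount]
  | [_] => by simp [adjCount]
  | a :: b :: w => by simp [adjCount, adjCount_eq_zero (w := b :: w)]

/-- The letters satisfying `P` are all alike for `r`: none of them is a second component of `r`, and
they are first components of the same pairs. -/
def IsBlind (r : A → A → Prop) (P : A → Prop) : Prop :=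
  (∀ a c, P c → ¬ r a c) ∧ ∀ c d b, P c → P d → (r c b ↔ r d b)

theorem IsBlind.adjCount_run {P : A → Prop} (h : IsBlind r P) {c : A} (hc : P c) (y : List A) :
    ∀ {u : List A}, u ≠ [] → (∀ d ∈ u, P d) → adjCount r (u ++ y) = adjCount r (c :: y)
  | [], hu, _ => absurd rfl hu
  | [d], _, hP => by
    cases y with
    | nil => simp [adjCount]
    | cons b y => simp [adjCount, h.2 d c b (hP d (by simp)) hc]
  | d :: e :: u, _, hP => by
    have hde : ¬ r d e := h.1 d e (hP e (by simp))
    rw [List.cons_append, List.cons_append, adjCount, if_neg hde, zero_add, ← List.cons_append]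
    exact adjCount_run h hc y (List.cons_ne_nil e u) fun a ha => hP a (List.mem_cons_of_mem _ ha)

theorem IsBlind.adjCount_replace {P : A → Prop} (h : IsBlind r P) {c : A} (hc : P c)
    {u : List A} (hu : u ≠ []) (huP : ∀ d ∈ u, P d) (x y : List A) :
    adjCount r (x ++ u ++ y) = adjCount r (x ++ c :: y) := by
  obtain ⟨d, u, rfl⟩ := List.exists_cons_of_ne_nil hu
  rw [List.append_assoc, List.cons_append,
    adjCount_append_cons fun a _ => h.1 a d (huP d (by simp)),
    adjCount_append_cons fun a _ => h.1 a c hc, ← List.cons_append, h.adjCount_run hc y hu huP]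

end AdjacentPairs

section Statistics

/-- The number of pairs of consecutive letters `a b` of `w` with `b < c < a`. -/
def straddle (c : ℕ) (w : List ℕ) : ℕ := adjCount (fun a b => b < c ∧ c < a) w

/-- The letter `c` is followed by a smaller letter in `w`. -/
def IsTopIn (c : ℕ) (w : List ℕ) : Prop := ¬ w.IsChain fun a b => ¬ (a = c ∧ b < c)

/-- The letter `c` is preceded by a larger letter in `w`. -/
def IsBottomIn (c : ℕ) (w : List ℕ) : Prop := ¬ w.IsChain fun a b => ¬ (b = c ∧ c < a)

variable {c v M : ℕ} {u x y : List ℕ}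

theorem straddle_replace (hc : c ≤ v) (hM : v < M) (hu : u ≠ []) (huv : ∀ d ∈ u, v < d)
    (x y : List ℕ) : straddle c (x ++ u ++ y) = straddle c (x ++ M :: y) :=
  IsBlind.adjCount_replace (P := (v < ·))
    ⟨fun _ _ _ _ => by omega, fun _ _ _ _ _ => by omega⟩ hM hu huv x y

theorem isTopIn_replace (hc : c ≤ v) (hM : v < M) (hu : u ≠ []) (huv : ∀ d ∈ u, v < d)
    (x y : List ℕ) : IsTopIn c (x ++ u ++ y) ↔ IsTopIn c (x ++ M :: y) := by
  rw [IsTopIn, IsTopIn, ← adjCount_eq_zero, ← adjCount_eq_zero,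
    IsBlind.adjCount_replace (P := (v < ·))
      ⟨fun _ _ _ _ => by omega, fun _ _ _ _ _ => by omega⟩ hM hu huv]

theorem isBottomIn_replace (hc : c ≤ v) (hM : v < M) (hu : u ≠ []) (huv : ∀ d ∈ u, v < d)
    (x y : List ℕ) : IsBottomIn c (x ++ u ++ y) ↔ IsBottomIn c (x ++ M :: y) := by
  rw [IsBottomIn, IsBottomIn, ← adjCount_eq_zero, ← adjCount_eq_zero,
    IsBlind.adjCount_replace (P := (v < ·))
      ⟨fun _ _ _ _ => by omega, fun _ _ _ _ _ => by omega⟩ hM hu huv]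

theorem isTopIn_append_cons (hx : c ∉ x) (hy : c ∉ y) :
    IsTopIn c (x ++ c :: y) ↔ ∃ b ∈ y.head?, b < c := by
  have hchain {w : List ℕ} (hw : c ∉ w) : w.IsChain fun a b => ¬ (a = c ∧ b < c) := by
    rw [List.isChain_iff_getElem]
    rintro i hi ⟨rfl, -⟩
    exact hw (List.getElem_mem _)
  rw [IsTopIn, List.isChain_append, List.isChain_cons]
  simp only [hchain hx, hchain hy, true_and]
  simp

theorem isBottomIn_append_cons (hx : c ∉ x) (hy : c ∉ y) :
    IsBottomIn c (x ++ c :: y) ↔ ∃ a ∈ x.getLast?, c < a := by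
  have hchain {w : List ℕ} (hw : c ∉ w) : w.IsChain fun a b => ¬ (b = c ∧ c < a) := by
    rw [List.isChain_iff_getElem]
    rintro i hi ⟨rfl, -⟩
    exact hw (List.getElem_mem _)
  rw [IsBottomIn, List.isChain_append, List.isChain_cons]
  simp only [hchain hx, hchain hy, true_and]
  simp

end Statistics

section ContextProduct

variable {A R : Type*} [Monoid R] {f : List A → A → List A → R} {x y x' y' : List A}

/-- The product of `f x₁ c y₁` over all ways of writing the word `x ++ w ++ y` as `x₁ ++ c :: y₁`
with the letter `c` in the factor `w`. -/
def contextProd (f : List A → A → List A → R) (x : List A) : List A → List A → R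
  | [], _ => 1
  | c :: w, y => f x c (w ++ y) * contextProd f (x ++ [c]) w y

theorem contextProd_append (w w' : List A) :
    contextProd f x (w ++ w') y = contextProd f x w (w' ++ y) * contextProd f (x ++ w) w' y := by
  induction w generalizing x with
  | nil => simp [contextProd]
  | cons c w ih => simp [contextProd, ih, mul_assoc]

theorem contextProd_congr {w : List A}
    (h : ∀ w₁ c w₂, w = w₁ ++ c :: w₂ → f (x ++ w₁) c (w₂ ++ y) = f (x' ++ w₁) c (w₂ ++ y')) :
    contextProd f x w y = contextProd f x' w y' := by
  induction w generalizing x x' with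
  | nil => rfl
  | cons c w ih =>
    rw [contextProd, contextProd, ih]
    · simpa using congrArg (· * _) (h [] c w rfl)
    · rintro w₁ d w₂ rfl
      simpa using h (c :: w₁) d w₂ rfl

end ContextProduct

section Weight

variable {R : Type*} [CommMonoid R]

/-- The contribution to `wordWeight` of a letter `c` standing between `x` and `y`. The mark `M` does
not contribute, and a descent is charged to its top. -/
def letterWeight (α : ℕ → R) (p q t : R) (M : ℕ) (x : List ℕ) (c : ℕ) (y : List ℕ) : R :=
  if c = M then 1 else
    (if ∀ a ∈ x, a < c then α c else 1) * p ^ straddle c y * q ^ straddle c x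
      * (if ∃ b ∈ y.head?, b < c then t else 1)

/-- The product of `α c` over the left-to-right maxima `c ≠ M` of `w`, of a factor `t` for each
descent, and of a factor `p` or `q` for each letter and each descent straddling it on its right or
on its left. -/
def wordWeight (α : ℕ → R) (p q t : R) (M : ℕ) (w : List ℕ) : R :=
  contextProd (letterWeight α p q t M) [] w []

variable {α : ℕ → R} {p q t : R} {M v : ℕ} {u x y : List ℕ}

theorem letterWeight_replace_right {c : ℕ} (hc : c ≤ v ∨ c = M) (hM : v < M) (hu : u ≠ [])
    (huv : ∀ d ∈ u, v < d) (w : List ℕ) :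
    letterWeight α p q t M x c (w ++ u ++ y) = letterWeight α p q t M x c (w ++ M :: y) := by
  rcases hc with hc | rfl
  · have htop : (∃ b ∈ (w ++ u ++ y).head?, b < c) ↔ ∃ b ∈ (w ++ M :: y).head?, b < c := by
      cases w with
      | nil =>
        obtain ⟨d, u, rfl⟩ := List.exists_cons_of_ne_nil hu
        have hd := huv d (by simp)
        simp only [List.nil_append, List.cons_append, List.head?_cons, Option.mem_some_iff,
          exists_eq_left']
        omega
      | cons => rfl
    simp only [letterWeight, straddle_replace hc hM hu huv, htop]
  · rw [letterWeight, letterWeight, if_pos rfl, if_pos rfl]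

theorem letterWeight_replace_left {c : ℕ} (hc : c ≤ v ∨ c = M) (hM : v < M) (hu : u ≠ [])
    (huv : ∀ d ∈ u, v < d) (w : List ℕ) :
    letterWeight α p q t M (x ++ u ++ w) c y = letterWeight α p q t M (x ++ M :: w) c y := by
  rcases hc with hc | rfl
  · have hmax : (∀ a ∈ x ++ u ++ w, a < c) ↔ ∀ a ∈ x ++ M :: w, a < c := by
      obtain ⟨d, hd⟩ := List.exists_mem_of_ne_nil u hu
      have hdv := huv d hd
      refine iff_of_false (fun h => ?_) fun h => ?_
      · have := h d (by simp [hd])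
        omega
      · have := h M (by simp)
        omega
    simp only [letterWeight, straddle_replace hc hM hu huv, hmax]
  · rw [letterWeight, letterWeight, if_pos rfl, if_pos rfl]

theorem wordWeight_replace (hM : v < M) (hu : u ≠ []) (huv : ∀ d ∈ u, v < d)
    (hxy : ∀ c ∈ x ++ y, c ≤ v ∨ c = M) :
    wordWeight α p q t M (x ++ u ++ y)
      = contextProd (letterWeight α p q t M) x u y * wordWeight α p q t M (x ++ M :: y) := by
  have hleft : contextProd (letterWeight α p q t M) [] x (u ++ y)
      = contextProd (letterWeight α p q t M) [] x (M :: y) := by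
    refine contextProd_congr ?_
    rintro w₁ c w₂ rfl
    rw [← List.append_assoc, letterWeight_replace_right (hxy c (by simp)) hM hu huv]
  have hright : contextProd (letterWeight α p q t M) (x ++ u) y []
      = contextProd (letterWeight α p q t M) (x ++ [M]) y [] := by
    refine contextProd_congr ?_
    rintro w₁ c w₂ rfl
    rw [List.append_assoc x [M], List.singleton_append,
      letterWeight_replace_left (hxy c (by simp)) hM hu huv]
  have hmark : contextProd (letterWeight α p q t M) x [M] y = 1 := by
    simp [contextProd, letterWeight]
  rw [wordWeight, wordWeight, List.append_assoc, contextProd_append, contextProd_append,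
    ← List.singleton_append (l := y), contextProd_append, contextProd_append]
  simp only [List.append_nil, List.nil_append, List.singleton_append, hmark, one_mul]
  rw [hleft, hright, mul_left_comm]

end Weight

section Separated

/-- No two consecutive letters of `w` are marks `M`. -/
def IsSeparated (M : ℕ) (w : List ℕ) : Prop := w.IsChain fun a b => ¬ (a = M ∧ b = M)

variable {v h M : ℕ} {w x y : List ℕ}

theorem straddle_concat_mark (hw : IsSeparated M (w ++ [M])) (hwv : ∀ c ∈ w, c ≤ v ∨ c = M)
    (hM : v + 1 < M) : straddle (v + 1) (w ++ [M]) = w.count M := by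
  induction w with
  | nil => simp [straddle, adjCount]
  | cons a w ih =>
    have ha := hwv a (by simp)
    have ih := ih hw.tail fun c hc => hwv c (List.mem_cons_of_mem _ hc)
    cases w with
    | nil =>
      have haM : a ≠ M := by simpa [IsSeparated] using hw
      simp [straddle, adjCount, haM, (Nat.lt_of_succ_lt hM).not_ge]
    | cons b w =>
      have hb := hwv b (by simp)
      have hab : ¬ (a = M ∧ b = M) := List.isChain_cons_cons.1 hw |>.1
      have hiff : b < v + 1 ∧ v + 1 < a ↔ a = M := by omega
      rw [List.cons_append, List.cons_append, straddle, adjCount, ← straddle, ← List.cons_append,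
        ih, List.count_cons (b := a), add_comm]
      simp only [hiff, beq_iff_eq]

theorem straddle_of_append_mark (hw : IsSeparated M (x ++ M :: y)) (hxv : ∀ c ∈ x, c ≤ v ∨ c = M)
    (hM : v + 1 < M) : straddle (v + 1) x = x.count M := by
  have hx : IsSeparated M (x ++ [M]) :=
    List.IsChain.left_of_append (l₂ := y) (by simpa [IsSeparated] using hw)
  rw [← straddle_concat_mark hx hxv hM, straddle, straddle, adjCount_concat fun _ _ => by omega]

theorem straddle_mark_cons (hw : IsSeparated M (M :: y)) (hyv : ∀ c ∈ y, c ≤ v ∨ c = M)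
    (hlast : (M :: y).getLast? = some M) (hM : v + 1 < M) :
    straddle (v + 1) (M :: y) = y.count M := by
  obtain ⟨z, hz⟩ := List.getLast?_eq_some_iff.1 hlast
  have hcount : y.count M + 1 = z.count M + 1 := by
    rw [← List.count_cons_self, hz, List.count_append, List.count_singleton_self]
  have hzv : ∀ c ∈ z, c ≤ v ∨ c = M := by
    intro c hc
    have : c ∈ M :: y := hz ▸ List.mem_append_left _ hc
    exact (List.mem_cons.1 this).elim Or.inr (hyv c)
  rw [hz] at hw ⊢
  rw [straddle_concat_mark hw hzv hM]
  omega

end Separated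

section ReplaceMark

variable {A R : Type*} [DecidableEq A] [NonUnitalNonAssocSemiring R]

/-- The word obtained from `w` by replacing its `i`-th letter `M`, counted from `0`, by `u`. -/
def replaceMark (u : List A) (M : A) : ℕ → List A → List A
  | _, [] => []
  | 0, c :: w => if c = M then u ++ w else c :: replaceMark u M 0 w
  | i + 1, c :: w => if c = M then c :: replaceMark u M i w else c :: replaceMark u M (i + 1) w

theorem replaceMark_append (u : List A) (M : A) (x y : List A) :
    replaceMark u M (x.count M) (x ++ M :: y) = x ++ u ++ y := by
  induction x with
  | nil => simp [replaceMark]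
  | cons c x ih =>
    by_cases hc : c = M
    · subst hc
      simpa [replaceMark] using ih
    · rw [List.count_cons_of_ne hc, List.cons_append]
      cases hx : x.count M <;> simpa [replaceMark, hc, hx] using ih

theorem exists_eq_append_of_lt_count {M : A} : ∀ {w : List A} {i : ℕ}, i < w.count M →
    ∃ x y, w = x ++ M :: y ∧ x.count M = i
  | c :: w, i, hi => by
    by_cases hc : c = M
    · subst hc
      cases i with
      | zero => exact ⟨[], w, rfl, rfl⟩
      | succ i =>
        obtain ⟨x, y, rfl, hx⟩ := exists_eq_append_of_lt_count (i := i) (by simpa using hi)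
        exact ⟨c :: x, y, rfl, by simp [hx]⟩
    · obtain ⟨x, y, rfl, hx⟩ := exists_eq_append_of_lt_count (by simpa [hc] using hi)
      exact ⟨c :: x, y, rfl, by simp [hc, hx]⟩

theorem sum_eq_of_mem_iff_replaceMark {S S' : Finset (List A)} {M m : A} {l r : List A} {k : ℕ}
    {F : List A → R} {g : ℕ → R} (hlr : m ∉ l ++ r) (hm : ∀ w ∈ S, m ∉ w)
    (hk : ∀ w ∈ S, k ≤ w.count M)
    (hS' : ∀ w, w ∈ S' ↔
      ∃ x y, x ++ M :: y ∈ S ∧ x.count M < k ∧ w = x ++ (l ++ m :: r) ++ y)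
    (hF : ∀ x y, x ++ M :: y ∈ S → x.count M < k →
      F (x ++ (l ++ m :: r) ++ y) = g (x.count M) * F (x ++ M :: y)) :
    ∑ w ∈ S', F w = (∑ i ∈ Finset.range k, g i) * ∑ w ∈ S, F w := by
  rw [Finset.sum_mul_sum, ← Finset.sum_product']
  symm
  have hsplit {a : ℕ × List A} (ha : a ∈ Finset.range k ×ˢ S) :
      ∃ x y, a = (x.count M, x ++ M :: y) := by
    obtain ⟨hi, hw⟩ := Finset.mem_product.1 ha
    obtain ⟨x, y, hxy, hx⟩ :=
      exists_eq_append_of_lt_count ((Finset.mem_range.1 hi).trans_le (hk _ hw))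
    exact ⟨x, y, Prod.ext hx.symm hxy⟩
  refine Finset.sum_bij (fun a _ => replaceMark (l ++ m :: r) M a.1 a.2) ?_ ?_ ?_ ?_
  · intro a ha
    obtain ⟨x, y, rfl⟩ := hsplit ha
    obtain ⟨hx, hxy⟩ := Finset.mem_product.1 ha
    rw [replaceMark_append, hS']
    exact ⟨x, y, hxy, Finset.mem_range.1 hx, rfl⟩
  · intro a ha b hb hab
    obtain ⟨x, y, rfl⟩ := hsplit ha
    obtain ⟨x', y', rfl⟩ := hsplit hb
    have hxy : m ∉ x ++ M :: y := hm _ (Finset.mem_product.1 ha).2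
    have hxl : m ∉ x ++ l := by grind
    have hry : m ∉ r ++ y := by grind
    have heq : (x ++ l) ++ m :: (r ++ y) = (x' ++ l) ++ m :: (r ++ y') := by
      simpa [replaceMark_append] using hab
    obtain ⟨hxx, -, hyy⟩ := (List.append_cons_inj_of_notMem hxl hry).1 heq
    rw [List.append_cancel_right hxx, List.append_cancel_left hyy]
  · intro w hw
    obtain ⟨x, y, hxy, hx, rfl⟩ := (hS' w).1 hw
    exact ⟨(x.count M, x ++ M :: y), Finset.mem_product.2 ⟨Finset.mem_range.2 hx, hxy⟩,
      replaceMark_append _ _ _ _⟩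
  · intro a ha
    obtain ⟨x, y, rfl⟩ := hsplit ha
    obtain ⟨hx, hxy⟩ := Finset.mem_product.1 ha
    rw [replaceMark_append, hF x y hxy (Finset.mem_range.1 hx)]

end ReplaceMark

section MarkedWords

/-- `w` is a word with letters `1, …, v`, each used once, and `h + 1` marks `M`, no two of them
consecutive, the last letter being a mark. Each mark stands for a maximal run of letters larger than
`v`; the final one is a sentinel, so that all the letters `1, …, v` have a successor. -/
structure IsMarkedWord (v h M : ℕ) (w : List ℕ) : Prop where
  perm : w.Perm (List.range' 1 v ++ List.replicate (h + 1) M)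
  isSeparated : IsSeparated M w
  getLast?_eq : w.getLast? = some M

variable {v h M : ℕ} {w x y z : List ℕ}

theorem IsMarkedWord.le_or_eq_mark (hw : IsMarkedWord v h M w) {c : ℕ} (hc : c ∈ w) :
    c ≤ v ∨ c = M := by
  have := hw.perm.mem_iff.1 hc
  simp only [List.mem_append, List.mem_range'_1, List.mem_replicate] at this
  omega

theorem IsMarkedWord.succ_notMem (hw : IsMarkedWord v h M w) (hM : v + 1 < M) : v + 1 ∉ w :=
  fun hmem => by have := hw.le_or_eq_mark hmem; omega

theorem IsMarkedWord.count_mark (hw : IsMarkedWord v h M w) (hM : v < M) :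
    w.count M = h + 1 := by
  have hMv : M ∉ List.range' 1 v := by rw [List.mem_range'_1]; omega
  rw [hw.perm.count_eq, List.count_append, List.count_eq_zero.2 hMv, List.count_replicate_self,
    zero_add]

theorem IsMarkedWord.count_add_count (hw : IsMarkedWord v h M (x ++ M :: y)) (hM : v < M) :
    x.count M + y.count M = h := by
  have := hw.count_mark hM
  rw [List.count_append, List.count_cons_self] at this
  omega

theorem perm_append_replicate_succ {A : Type*} {M : A} {l x y : List A} {k : ℕ} :
    (x ++ M :: y).Perm (l ++ List.replicate (k + 1) M) ↔
      (x ++ y).Perm (l ++ List.replicate k M) := by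
  rw [List.replicate_succ, List.perm_middle.congr_left, List.perm_middle.congr_right,
    List.perm_cons]

theorem isSeparated_mark_cons : IsSeparated M (M :: y) ↔ IsSeparated M y ∧ y.head? ≠ some M := by
  rw [IsSeparated, List.isChain_cons, and_comm, IsSeparated]
  cases y.head? <;> simp

theorem isSeparated_concat_mark :
    IsSeparated M (x ++ [M]) ↔ IsSeparated M x ∧ x.getLast? ≠ some M := by
  rw [IsSeparated, List.isChain_append, IsSeparated]
  cases x.getLast? <;> simp

theorem isMarkedWord_append_mark_cons :
    IsMarkedWord v h M (x ++ M :: y) ↔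
      (x ++ M :: y).Perm (List.range' 1 v ++ List.replicate (h + 1) M)
        ∧ (IsSeparated M x ∧ x.getLast? ≠ some M) ∧ (IsSeparated M y ∧ y.head? ≠ some M)
        ∧ (M :: y).getLast? = some M := by
  have hsep : IsSeparated M (x ++ M :: y) ↔
      (IsSeparated M x ∧ x.getLast? ≠ some M) ∧ (IsSeparated M y ∧ y.head? ≠ some M) := by
    rw [IsSeparated, List.isChain_append, List.isChain_cons, IsSeparated, IsSeparated]
    aesop
  have hlast : (x ++ M :: y).getLast? = some M ↔ (M :: y).getLast? = some M := by simp
  exact ⟨fun hw => ⟨hw.perm, (hsep.1 hw.isSeparated).1, (hsep.1 hw.isSeparated).2,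
    hlast.1 hw.getLast?_eq⟩, fun ⟨hp, hx, hy, hl⟩ => ⟨hp, hsep.2 ⟨hx, hy⟩, hlast.2 hl⟩⟩

theorem isMarkedWord_append_succ_cons (hM : v + 1 ≠ M) :
    IsMarkedWord (v + 1) h M (x ++ (v + 1) :: z) ↔
      (x ++ z).Perm (List.range' 1 v ++ List.replicate (h + 1) M)
        ∧ IsSeparated M x ∧ IsSeparated M z ∧ z.getLast? = some M := by
  have hperm : (x ++ (v + 1) :: z).Perm (List.range' 1 (v + 1) ++ List.replicate (h + 1) M) ↔
      (x ++ z).Perm (List.range' 1 v ++ List.replicate (h + 1) M) := by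
    rw [List.range'_concat, List.append_assoc, List.singleton_append, mul_comm, mul_one,
      add_comm 1 v, List.perm_middle.congr_left, List.perm_middle.congr_right, List.perm_cons]
  have hsep : IsSeparated M (x ++ (v + 1) :: z) ↔ IsSeparated M x ∧ IsSeparated M z := by
    rw [IsSeparated, List.isChain_append, List.isChain_cons, IsSeparated, IsSeparated]
    simp [hM]
  have hlast : (x ++ (v + 1) :: z).getLast? = some M ↔ z.getLast? = some M := by
    cases z <;> simp [hM]
  exact ⟨fun hw => ⟨hperm.1 hw.perm, (hsep.1 hw.isSeparated).1, (hsep.1 hw.isSeparated).2,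
    hlast.1 hw.getLast?_eq⟩, fun ⟨hp, hx, hz, hl⟩ => ⟨hperm.2 hp, hsep.2 ⟨hx, hz⟩, hlast.2 hl⟩⟩

theorem IsMarkedWord.exists_eq_append_succ (hw : IsMarkedWord (v + 1) h M w) :
    ∃ x z, w = x ++ (v + 1) :: z :=
  List.append_of_mem (hw.perm.mem_iff.2 (by simp))

theorem IsMarkedWord.le_or_eq_mark_of_append_succ
    (hw : IsMarkedWord (v + 1) h M (x ++ (v + 1) :: z)) (hM : v + 1 ≠ M) {c : ℕ}
    (hc : c ∈ x ++ z) : c ≤ v ∨ c = M := by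
  have := ((isMarkedWord_append_succ_cons hM).1 hw).1.mem_iff.1 hc
  simp only [List.mem_append, List.mem_range'_1, List.mem_replicate] at this
  omega

theorem IsMarkedWord.isBottomIn_succ_iff (hw : IsMarkedWord (v + 1) h M (x ++ (v + 1) :: z))
    (hM : v + 1 < M) : IsBottomIn (v + 1) (x ++ (v + 1) :: z) ↔ x.getLast? = some M := by
  have hle {c : ℕ} (hc : c ∈ x ++ z) := hw.le_or_eq_mark_of_append_succ hM.ne hc
  rw [isBottomIn_append_cons (fun hx => by have := hle (List.mem_append_left z hx); omega)
    (fun hz => by have := hle (List.mem_append_right x hz); omega)]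
  constructor
  · rintro ⟨a, ha, hva⟩
    have := hle (List.mem_append_left z (List.mem_of_getLast? ha))
    obtain rfl : a = M := by omega
    exact ha
  · exact fun h => ⟨M, h, hM⟩

theorem IsMarkedWord.isTopIn_succ_iff (hw : IsMarkedWord (v + 1) h M (x ++ (v + 1) :: z))
    (hM : v + 1 < M) : IsTopIn (v + 1) (x ++ (v + 1) :: z) ↔ z.head? ≠ some M := by
  have hle {c : ℕ} (hc : c ∈ x ++ z) := hw.le_or_eq_mark_of_append_succ hM.ne hc
  rw [isTopIn_append_cons (fun hx => by have := hle (List.mem_append_left z hx); omega)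
    (fun hz => by have := hle (List.mem_append_right x hz); omega)]
  have hz : z ≠ [] := by
    rintro rfl
    simpa using ((isMarkedWord_append_succ_cons hM.ne).1 hw).2.2.2
  obtain ⟨b, z, rfl⟩ := List.exists_cons_of_ne_nil hz
  have := hle (c := b) (by simp)
  simp only [List.head?_cons, Option.mem_some_iff, exists_eq_left', ne_eq, Option.some.injEq]
  omega

end MarkedWords

section Insertion

variable {v h M : ℕ} {w : List ℕ}

theorem isMarkedWord_succ_level_iff (hM : v + 1 < M) :
    IsMarkedWord (v + 1) h M w ∧ ¬ IsBottomIn (v + 1) w ∧ ¬ IsTopIn (v + 1) w ↔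
      ∃ x y, IsMarkedWord v h M (x ++ M :: y) ∧ w = x ++ (v + 1) :: M :: y := by
  constructor
  · rintro ⟨hw, hbot, htop⟩
    obtain ⟨x, z, rfl⟩ := hw.exists_eq_append_succ
    rw [hw.isBottomIn_succ_iff hM] at hbot
    rw [hw.isTopIn_succ_iff hM, ne_eq, not_not, List.head?_eq_some_iff] at htop
    obtain ⟨y, rfl⟩ := htop
    obtain ⟨hperm, hx, hy, hlast⟩ := (isMarkedWord_append_succ_cons hM.ne).1 hw
    exact ⟨x, y, isMarkedWord_append_mark_cons.2
      ⟨hperm, ⟨hx, hbot⟩, isSeparated_mark_cons.1 hy, hlast⟩, rfl⟩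
  · rintro ⟨x, y, hxy, rfl⟩
    obtain ⟨hperm, ⟨hx, hxM⟩, hy, hlast⟩ := isMarkedWord_append_mark_cons.1 hxy
    have hw : IsMarkedWord (v + 1) h M (x ++ (v + 1) :: M :: y) :=
      (isMarkedWord_append_succ_cons hM.ne).2 ⟨hperm, hx, isSeparated_mark_cons.2 hy, hlast⟩
    rw [hw.isBottomIn_succ_iff hM, hw.isTopIn_succ_iff hM]
    exact ⟨hw, hxM, by simp⟩

theorem isMarkedWord_succ_valley_iff (hM : v + 1 < M) :
    IsMarkedWord (v + 1) (h + 1) M w ∧ IsBottomIn (v + 1) w ∧ ¬ IsTopIn (v + 1) w ↔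
      ∃ x y, IsMarkedWord v h M (x ++ M :: y) ∧ w = x ++ M :: (v + 1) :: M :: y := by
  have hperm_iff (x y : List ℕ) :
      ((x ++ [M]) ++ M :: y).Perm (List.range' 1 v ++ List.replicate (h + 2) M) ↔
        (x ++ M :: y).Perm (List.range' 1 v ++ List.replicate (h + 1) M) := by
    rw [List.append_assoc, List.singleton_append, perm_append_replicate_succ]
  constructor
  · rintro ⟨hw, hbot, htop⟩
    obtain ⟨x', z, rfl⟩ := hw.exists_eq_append_succ
    rw [hw.isBottomIn_succ_iff hM, List.getLast?_eq_some_iff] at hbot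
    rw [hw.isTopIn_succ_iff hM, ne_eq, not_not, List.head?_eq_some_iff] at htop
    obtain ⟨x, rfl⟩ := hbot
    obtain ⟨y, rfl⟩ := htop
    obtain ⟨hperm, hx, hy, hlast⟩ := (isMarkedWord_append_succ_cons hM.ne).1 hw
    exact ⟨x, y, isMarkedWord_append_mark_cons.2 ⟨(hperm_iff x y).1 hperm,
      isSeparated_concat_mark.1 hx, isSeparated_mark_cons.1 hy, hlast⟩, by simp⟩
  · rintro ⟨x, y, hxy, rfl⟩
    obtain ⟨hperm, hx, hy, hlast⟩ := isMarkedWord_append_mark_cons.1 hxy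
    have hw : IsMarkedWord (v + 1) (h + 1) M ((x ++ [M]) ++ (v + 1) :: M :: y) :=
      (isMarkedWord_append_succ_cons hM.ne).2 ⟨(hperm_iff x y).2 hperm,
        isSeparated_concat_mark.2 hx, isSeparated_mark_cons.2 hy, hlast⟩
    rw [← List.singleton_append (l := (v + 1) :: M :: y), ← List.append_assoc,
      hw.isBottomIn_succ_iff hM, hw.isTopIn_succ_iff hM]
    exact ⟨hw, by simp, by simp⟩

theorem isMarkedWord_succ_peak_iff (hM : v + 1 < M) :
    IsMarkedWord (v + 1) h M w ∧ ¬ IsBottomIn (v + 1) w ∧ IsTopIn (v + 1) w ↔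
      ∃ x y, IsMarkedWord v (h + 1) M (x ++ M :: y) ∧ y ≠ [] ∧ w = x ++ (v + 1) :: y := by
  constructor
  · rintro ⟨hw, hbot, htop⟩
    obtain ⟨x, y, rfl⟩ := hw.exists_eq_append_succ
    rw [hw.isBottomIn_succ_iff hM] at hbot
    rw [hw.isTopIn_succ_iff hM] at htop
    obtain ⟨hperm, hx, hy, hlast⟩ := (isMarkedWord_append_succ_cons hM.ne).1 hw
    have hne : y ≠ [] := by rintro rfl; simp at hlast
    exact ⟨x, y, isMarkedWord_append_mark_cons.2 ⟨perm_append_replicate_succ.2 hperm,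
      ⟨hx, hbot⟩, ⟨hy, htop⟩, by rwa [List.getLast?_cons_of_ne_nil hne]⟩, hne, rfl⟩
  · rintro ⟨x, y, hxy, hne, rfl⟩
    obtain ⟨hperm, ⟨hx, hxM⟩, ⟨hy, hyM⟩, hlast⟩ := isMarkedWord_append_mark_cons.1 hxy
    rw [List.getLast?_cons_of_ne_nil hne] at hlast
    have hw : IsMarkedWord (v + 1) h M (x ++ (v + 1) :: y) :=
      (isMarkedWord_append_succ_cons hM.ne).2 ⟨perm_append_replicate_succ.1 hperm, hx, hy, hlast⟩
    rw [hw.isBottomIn_succ_iff hM, hw.isTopIn_succ_iff hM]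
    exact ⟨hw, hxM, hyM⟩

theorem IsMarkedWord.not_isBottomIn_succ (hw : IsMarkedWord (v + 1) 0 M w) (hM : v + 1 < M) :
    ¬ IsBottomIn (v + 1) w := by
  obtain ⟨x, z, rfl⟩ := hw.exists_eq_append_succ
  have hz : M ∈ z :=
    List.mem_of_getLast? ((isMarkedWord_append_succ_cons hM.ne).1 hw).2.2.2
  have hcount := hw.count_mark hM
  rw [List.count_append, List.count_cons_of_ne hM.ne] at hcount
  rw [hw.isBottomIn_succ_iff hM]
  intro hx
  have hx := List.count_pos_iff.2 (List.mem_of_getLast? hx)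
  have hz := List.count_pos_iff.2 hz
  omega

end Insertion

section InsertionWeight

variable {R : Type*} [CommMonoid R] {α : ℕ → R} {p q t : R} {v h M : ℕ} {x y : List ℕ}

theorem forall_lt_succ_iff_count_eq_zero (hx : ∀ c ∈ x, c ≤ v ∨ c = M) (hM : v + 1 < M) :
    (∀ a ∈ x, a < v + 1) ↔ x.count M = 0 := by
  rw [List.count_eq_zero]
  refine ⟨fun h hMx => (h M hMx).not_gt hM, fun h a ha => ?_⟩
  have : a ≠ M := fun haM => h (haM ▸ ha)
  have := hx a ha
  omega

theorem contextProd_level (hw : IsMarkedWord v h M (x ++ M :: y)) (hM : v + 1 < M) :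
    contextProd (letterWeight α p q t M) x [v + 1, M] y
      = (if x.count M = 0 then α (v + 1) else 1) * p ^ (h - x.count M) * q ^ x.count M := by
  have hle (c : ℕ) (hc : c ∈ x ++ M :: y) := hw.le_or_eq_mark hc
  have hx (c : ℕ) (hc : c ∈ x) : c ≤ v ∨ c = M := hle c (by simp [hc])
  have hy (c : ℕ) (hc : c ∈ y) : c ≤ v ∨ c = M := hle c (by simp [hc])
  obtain ⟨-, -, hsep, hlast⟩ := isMarkedWord_append_mark_cons.1 hw
  have hcount := hw.count_add_count (by omega)
  have hr : straddle (v + 1) (M :: y) = h - x.count M := by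
    rw [straddle_mark_cons (isSeparated_mark_cons.2 hsep) hy hlast hM]
    omega
  have htop : ¬ ∃ b ∈ (M :: y).head?, b < v + 1 := by simpa using hM.le
  simp only [contextProd, letterWeight, if_pos, if_neg hM.ne, if_neg htop, hr, List.nil_append,
    List.cons_append, mul_one, forall_lt_succ_iff_count_eq_zero hx hM,
    straddle_of_append_mark hw.isSeparated hx hM]

theorem contextProd_valley (hw : IsMarkedWord v h M (x ++ M :: y)) (hM : v + 1 < M) :
    contextProd (letterWeight α p q t M) x [M, v + 1, M] y
      = p ^ (h - x.count M) * q ^ x.count M := by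
  have hle (c : ℕ) (hc : c ∈ x ++ M :: y) := hw.le_or_eq_mark hc
  have hx (c : ℕ) (hc : c ∈ x) : c ≤ v ∨ c = M := hle c (by simp [hc])
  have hy (c : ℕ) (hc : c ∈ y) : c ≤ v ∨ c = M := hle c (by simp [hc])
  obtain ⟨-, hxM, hsep, hlast⟩ := isMarkedWord_append_mark_cons.1 hw
  have hcount := hw.count_add_count (by omega)
  have hr : straddle (v + 1) (M :: y) = h - x.count M := by
    rw [straddle_mark_cons (isSeparated_mark_cons.2 hsep) hy hlast hM]
    omega
  have hl : straddle (v + 1) (x ++ [M]) = x.count M :=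
    straddle_concat_mark (isSeparated_concat_mark.2 hxM) hx hM
  have hnotmax : ¬ ∀ a ∈ x ++ [M], a < v + 1 := fun hlt => (hlt M (by simp)).not_gt hM
  have htop : ¬ ∃ b ∈ (M :: y).head?, b < v + 1 := by simpa using hM.le
  simp only [contextProd, letterWeight, if_pos, if_neg hM.ne, if_neg hnotmax, if_neg htop, hl, hr,
    List.nil_append, List.cons_append, mul_one, one_mul]

theorem contextProd_peak (hw : IsMarkedWord v (h + 1) M (x ++ M :: y)) (hy : y ≠ [])
    (hM : v + 1 < M) :
    contextProd (letterWeight α p q t M) x [v + 1] y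
      = (if x.count M = 0 then α (v + 1) else 1) * p ^ (h - x.count M) * q ^ x.count M * t := by
  obtain ⟨b, y, rfl⟩ := List.exists_cons_of_ne_nil hy
  have hle (c : ℕ) (hc : c ∈ x ++ M :: b :: y) := hw.le_or_eq_mark hc
  have hx (c : ℕ) (hc : c ∈ x) : c ≤ v ∨ c = M := hle c (by simp [hc])
  have hy (c : ℕ) (hc : c ∈ b :: y) : c ≤ v ∨ c = M := hle c (by simp_all)
  obtain ⟨-, -, hsep, hlast⟩ := isMarkedWord_append_mark_cons.1 hw
  have hb : b < v + 1 := by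
    have hbM : b ≠ M := by simpa using hsep.2
    have := hy b (by simp)
    omega
  have hcount := hw.count_add_count (by omega)
  have hr : straddle (v + 1) (b :: y) = h - x.count M := by
    have hstraddle := straddle_mark_cons (isSeparated_mark_cons.2 hsep) hy hlast hM
    rw [straddle, adjCount, if_pos ⟨hb, hM⟩, ← straddle] at hstraddle
    omega
  have htop : ∃ c ∈ (b :: y).head?, c < v + 1 := ⟨b, rfl, hb⟩
  simp only [contextProd, letterWeight, if_neg hM.ne, if_pos htop, hr, List.nil_append, mul_one,
    forall_lt_succ_iff_count_eq_zero hx hM, straddle_of_append_mark hw.isSeparated hx hM]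

end InsertionWeight

section MarkedSum

open Classical in
/-- The finite set of the words `w` with `IsMarkedWord v h M w` that satisfy `Q`. -/
noncomputable def markedWords (v h M : ℕ) (Q : List ℕ → Prop) : Finset (List ℕ) :=
  (List.range' 1 v ++ List.replicate (h + 1) M).permutations.toFinset.filter
    fun w => IsMarkedWord v h M w ∧ Q w

theorem mem_markedWords {v h M : ℕ} {Q : List ℕ → Prop} {w : List ℕ} :
    w ∈ markedWords v h M Q ↔ IsMarkedWord v h M w ∧ Q w := by
  simpa [markedWords] using fun hw _ => IsMarkedWord.perm hw

/-- `Q w` only depends on which of the letters `c ≤ v` are descent tops and which are descent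
bottoms of `w`. -/
def DependsOnTypes (v : ℕ) (Q : List ℕ → Prop) : Prop :=
  ∀ w w', (∀ c ≤ v, (IsTopIn c w ↔ IsTopIn c w') ∧ (IsBottomIn c w ↔ IsBottomIn c w')) →
    (Q w ↔ Q w')

variable {R : Type*} [CommSemiring R]

/-- The weighted number of the marked words satisfying `Q`. -/
noncomputable def markedSum (α : ℕ → R) (p q t : R) (v h M : ℕ) (Q : List ℕ → Prop) : R :=
  ∑ w ∈ markedWords v h M Q, wordWeight α p q t M w

variable {α : ℕ → R} {p q t : R} {v h h' M : ℕ} {Q T : List ℕ → Prop}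

theorem markedSum_congr {Q' : List ℕ → Prop} (hQ : ∀ w, IsMarkedWord v h M w → (Q w ↔ Q' w)) :
    markedSum α p q t v h M Q = markedSum α p q t v h M Q' := by
  refine Finset.sum_congr (Finset.ext fun w => ?_) fun _ _ => rfl
  rw [mem_markedWords, mem_markedWords, and_congr_right (hQ w)]

theorem markedSum_eq_add (T : List ℕ → Prop) :
    markedSum α p q t v h M Q = markedSum α p q t v h M (fun w => T w ∧ Q w)
      + markedSum α p q t v h M (fun w => ¬ T w ∧ Q w) := by
  classical
  rw [markedSum, ← Finset.sum_filter_add_sum_filter_not _ T]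
  congr 1 <;> refine Finset.sum_congr (Finset.ext fun w => ?_) fun _ _ => rfl <;>
    simp only [Finset.mem_filter, mem_markedWords, and_assoc, and_comm (a := Q w)]

theorem markedSum_succ_of_iff {l r : List ℕ} {k : ℕ} {g : ℕ → R} (hM : v + 1 < M)
    (hl : ∀ d ∈ l ++ r, v + 1 < d) (hk : k ≤ h + 1) (hQ : DependsOnTypes v Q)
    (hT : ∀ w, IsMarkedWord (v + 1) h' M w ∧ T w ↔ ∃ x y, IsMarkedWord v h M (x ++ M :: y)
      ∧ x.count M < k ∧ w = x ++ (l ++ (v + 1) :: r) ++ y)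
    (hg : ∀ x y, IsMarkedWord v h M (x ++ M :: y) → x.count M < k →
      contextProd (letterWeight α p q t M) x (l ++ (v + 1) :: r) y = g (x.count M)) :
    markedSum α p q t (v + 1) h' M (fun w => T w ∧ Q w)
      = (∑ i ∈ Finset.range k, g i) * markedSum α p q t v h M Q := by
  have hu : l ++ (v + 1) :: r ≠ [] := by simp
  have huv (d : ℕ) (hd : d ∈ l ++ (v + 1) :: r) : v < d := by
    rcases List.mem_cons.1 (List.perm_middle.mem_iff.1 hd) with rfl | hd
    · exact v.lt_succ_self
    · exact Nat.lt_of_succ_lt (hl d hd)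
  have hQ_replace (x y : List ℕ) :
      Q (x ++ (l ++ (v + 1) :: r) ++ y) ↔ Q (x ++ M :: y) :=
    hQ _ _ fun c hc => ⟨isTopIn_replace hc (Nat.lt_of_succ_lt hM) hu huv x y,
      isBottomIn_replace hc (Nat.lt_of_succ_lt hM) hu huv x y⟩
  refine sum_eq_of_mem_iff_replaceMark (M := M) (fun hmem => (hl _ hmem).false) ?_ ?_ ?_ ?_
  · exact fun w hw => (mem_markedWords.1 hw).1.succ_notMem hM
  · intro w hw
    rwa [(mem_markedWords.1 hw).1.count_mark (Nat.lt_of_succ_lt hM)]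
  · intro w
    rw [mem_markedWords, ← and_assoc, hT]
    simp only [mem_markedWords]
    constructor
    · rintro ⟨⟨x, y, hxy, hx, rfl⟩, hQw⟩
      exact ⟨x, y, ⟨hxy, (hQ_replace x y).1 hQw⟩, hx, rfl⟩
    · rintro ⟨x, y, ⟨hxy, hQxy⟩, hx, rfl⟩
      exact ⟨⟨x, y, hxy, hx, rfl⟩, (hQ_replace x y).2 hQxy⟩
  · intro x y hxy hx
    have hw := (mem_markedWords.1 hxy).1
    rw [wordWeight_replace (Nat.lt_of_succ_lt hM) hu huv fun c hc => hw.le_or_eq_mark (by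
      rw [List.perm_middle.mem_iff]; exact List.mem_cons_of_mem _ hc), hg x y hw hx]

theorem markedSum_valley_zero (hM : v + 1 < M) :
    markedSum α p q t (v + 1) 0 M
      (fun w => (IsBottomIn (v + 1) w ∧ ¬ IsTopIn (v + 1) w) ∧ Q w) = 0 := by
  refine Finset.sum_eq_zero fun w hw => ?_
  obtain ⟨hw, ⟨hbot, -⟩, -⟩ := mem_markedWords.1 hw
  exact absurd hbot (hw.not_isBottomIn_succ hM)

end MarkedSum

section MarkedSumRecursion

variable {R : Type*} [CommRing R] {α : ℕ → R} {p q t : R} {v h M : ℕ} {Q : List ℕ → Prop}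

theorem pqBracket_succ (p q x : R) (h : ℕ) :
    pqBracket p q x (h + 1)
      = ∑ i ∈ Finset.range (h + 1), (if i = 0 then x else 1) * p ^ (h - i) * q ^ i := by
  rw [pqBracket, Finset.range_eq_Ico, Finset.sum_eq_sum_Ico_succ_bot (Nat.succ_pos h)]
  simp only [if_true, Nat.sub_zero, pow_zero, mul_one, Nat.add_sub_cancel, zero_add]
  congr 1
  refine Finset.sum_congr rfl fun i hi => ?_
  rw [if_neg (Nat.one_le_iff_ne_zero.1 (Finset.mem_Ico.1 hi).1), one_mul]

theorem markedSum_level (hM : v + 1 < M) (hQ : DependsOnTypes v Q) :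
    markedSum α p q t (v + 1) h M
        (fun w => (¬ IsBottomIn (v + 1) w ∧ ¬ IsTopIn (v + 1) w) ∧ Q w)
      = pqBracket p q (α (v + 1)) (h + 1) * markedSum α p q t v h M Q := by
  rw [pqBracket_succ]
  refine markedSum_succ_of_iff (l := []) (r := [M]) hM (by simpa using hM) le_rfl hQ (fun w => ?_)
    fun x y hw _ => contextProd_level hw hM
  rw [isMarkedWord_succ_level_iff hM]
  refine exists₂_congr fun x y => and_congr_right fun hxy => ?_
  have := hxy.count_add_count (by omega)
  simp [show x.count M < h + 1 by omega]

theorem markedSum_valley (hM : v + 1 < M) (hQ : DependsOnTypes v Q) :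
    markedSum α p q t (v + 1) (h + 1) M
        (fun w => (IsBottomIn (v + 1) w ∧ ¬ IsTopIn (v + 1) w) ∧ Q w)
      = pqBracket p q 1 (h + 1) * markedSum α p q t v h M Q := by
  rw [pqBracket_succ]
  refine markedSum_succ_of_iff (l := [M]) (r := [M]) hM (by simpa using hM) le_rfl hQ (fun w => ?_)
    fun x y hw _ => by simpa using contextProd_valley hw hM
  rw [isMarkedWord_succ_valley_iff hM]
  refine exists₂_congr fun x y => and_congr_right fun hxy => ?_
  have := hxy.count_add_count (by omega)
  simp [show x.count M < h + 1 by omega]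

theorem markedSum_peak (hM : v + 1 < M) (hQ : DependsOnTypes v Q) :
    markedSum α p q t (v + 1) h M
        (fun w => (¬ IsBottomIn (v + 1) w ∧ IsTopIn (v + 1) w) ∧ Q w)
      = t * pqBracket p q (α (v + 1)) (h + 1) * markedSum α p q t v (h + 1) M Q := by
  have hcount {x y : List ℕ} (hxy : IsMarkedWord v (h + 1) M (x ++ M :: y)) :
      x.count M < h + 1 ↔ y ≠ [] := by
    have hc := hxy.count_add_count (by omega)
    refine ⟨by rintro hx rfl; simp at hc; omega, fun hy => ?_⟩
    have hlast := (isMarkedWord_append_mark_cons.1 hxy).2.2.2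
    rw [List.getLast?_cons_of_ne_nil hy] at hlast
    have := List.count_pos_iff.2 (List.mem_of_getLast? hlast)
    omega
  rw [pqBracket_succ, mul_comm t, Finset.sum_mul]
  refine markedSum_succ_of_iff (l := []) (r := []) hM (by simp) (Nat.le_succ _) hQ (fun w => ?_)
    fun x y hw hx => contextProd_peak hw ((hcount hw).1 hx) hM
  rw [isMarkedWord_succ_peak_iff hM]
  refine exists₂_congr fun x y => and_congr_right fun hxy => ?_
  simp [hcount hxy]

end MarkedSumRecursion

section EWords

/-- The condition of `IsEPerm`, for words containing the letters `1, …, 2 * n`: no odd letter is a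
descent top, no even letter is a descent bottom, and for no `j < n` the letters `2 * j + 1` and
`2 * j + 2` are simultaneously a descent bottom and a descent top. -/
def IsEWord (n : ℕ) (w : List ℕ) : Prop :=
  ∀ j < n, ¬ IsTopIn (2 * j + 1) w ∧ ¬ IsBottomIn (2 * j + 2) w
    ∧ ¬ (IsBottomIn (2 * j + 1) w ∧ IsTopIn (2 * j + 2) w)

variable {v n : ℕ} {Q Q' : List ℕ → Prop}

theorem isEWord_succ {w : List ℕ} : IsEWord (n + 1) w ↔
    (¬ IsTopIn (2 * n + 1) w ∧ ¬ IsBottomIn (2 * n + 2) w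
      ∧ ¬ (IsBottomIn (2 * n + 1) w ∧ IsTopIn (2 * n + 2) w)) ∧ IsEWord n w :=
  Nat.forall_lt_succ_right.trans and_comm

theorem dependsOnTypes_isTopIn {c : ℕ} (hc : c ≤ v) : DependsOnTypes v (IsTopIn c) :=
  fun _ _ h => (h c hc).1

theorem dependsOnTypes_isBottomIn {c : ℕ} (hc : c ≤ v) : DependsOnTypes v (IsBottomIn c) :=
  fun _ _ h => (h c hc).2

theorem DependsOnTypes.not (hQ : DependsOnTypes v Q) : DependsOnTypes v fun w => ¬ Q w :=
  fun w w' h => not_congr (hQ w w' h)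

theorem DependsOnTypes.and (hQ : DependsOnTypes v Q) (hQ' : DependsOnTypes v Q') :
    DependsOnTypes v fun w => Q w ∧ Q' w :=
  fun w w' h => and_congr (hQ w w' h) (hQ' w w' h)

theorem dependsOnTypes_isEWord (hn : 2 * n ≤ v) : DependsOnTypes v (IsEWord n) :=
  fun w w' h => forall₂_congr fun j hj => by
    rw [(h (2 * j + 1) (by omega)).1, (h (2 * j + 1) (by omega)).2,
      (h (2 * j + 2) (by omega)).1, (h (2 * j + 2) (by omega)).2]

theorem markedSum_isEWord_zero {R : Type*} [CommSemiring R] {α : ℕ → R} {p q t : R} (h M : ℕ) :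
    markedSum α p q t 0 h M (IsEWord 0) = if h = 0 then 1 else 0 := by
  have hE (w : List ℕ) : IsEWord 0 w := fun j hj => absurd hj j.not_lt_zero
  split_ifs with hh
  · subst hh
    have : markedWords 0 0 M (IsEWord 0) = {[M]} := by
      ext w
      rw [mem_markedWords, Finset.mem_singleton]
      constructor
      · rintro ⟨hw, -⟩
        simpa using hw.perm
      · rintro rfl
        exact ⟨⟨by simp, List.isChain_singleton M, rfl⟩, hE _⟩
    rw [markedSum, this, Finset.sum_singleton]
    simp [wordWeight, contextProd, letterWeight]
  · refine Finset.sum_eq_zero fun w hw => ?_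
    obtain ⟨k, rfl⟩ := Nat.exists_eq_succ_of_ne_zero hh
    have hw := (mem_markedWords.1 hw).1
    have hrep : w = List.replicate (k + 1 + 1) M := List.perm_replicate.1 (by simpa using hw.perm)
    have hsep := hw.isSeparated
    rw [hrep, IsSeparated, List.replicate_succ, List.replicate_succ, List.isChain_cons_cons] at hsep
    exact absurd ⟨rfl, rfl⟩ hsep.1

variable {R : Type*} [CommRing R] {α : ℕ → R} {p q t : R} {h M : ℕ}

theorem markedSum_isEWord_top (hM : 2 * n + 2 < M) :
    markedSum α p q t (2 * n + 2) h M (fun w => IsTopIn (2 * n + 2) w ∧ IsEWord (n + 1) w)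
      = t * pqBracket p q (α (2 * n + 2)) (h + 1) * pqBracket p q (α (2 * n + 1)) (h + 2)
        * markedSum α p q t (2 * n) (h + 1) M (IsEWord n) := by
  have hlevel := dependsOnTypes_isBottomIn (le_refl (2 * n + 1)) |>.not.and
    (dependsOnTypes_isTopIn le_rfl).not |>.and (dependsOnTypes_isEWord (Nat.le_succ (2 * n)))
  rw [mul_assoc _ (pqBracket p q (α (2 * n + 1)) _),
    ← markedSum_level (by omega) (dependsOnTypes_isEWord le_rfl), ← markedSum_peak hM hlevel]
  refine markedSum_congr fun w _ => ?_
  rw [isEWord_succ]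
  tauto

theorem markedSum_isEWord_not_top (hM : 2 * n + 2 < M) :
    markedSum α p q t (2 * n + 2) h M (fun w => ¬ IsTopIn (2 * n + 2) w ∧ IsEWord (n + 1) w)
      = pqBracket p q (α (2 * n + 2)) (h + 1)
        * (markedSum α p q t (2 * n + 1) h M
            (fun w => (IsBottomIn (2 * n + 1) w ∧ ¬ IsTopIn (2 * n + 1) w) ∧ IsEWord n w)
          + pqBracket p q (α (2 * n + 1)) (h + 1) * markedSum α p q t (2 * n) h M (IsEWord n)) := by
  have hodd := (dependsOnTypes_isTopIn (le_refl (2 * n + 1))).not.and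
    (dependsOnTypes_isEWord (Nat.le_succ (2 * n)))
  rw [← markedSum_level (by omega) (dependsOnTypes_isEWord le_rfl)]
  have hsplit := markedSum_eq_add (α := α) (p := p) (q := q) (t := t) (v := 2 * n + 1) (h := h)
    (M := M) (Q := fun w => ¬ IsTopIn (2 * n + 1) w ∧ IsEWord n w) (IsBottomIn (2 * n + 1))
  simp only [← and_assoc] at hsplit
  rw [← hsplit, ← markedSum_level hM hodd]
  refine markedSum_congr fun w _ => ?_
  rw [isEWord_succ]
  tauto

theorem markedSum_isEWord_eq_motzkin (n h : ℕ) (hM : 2 * n < M) {a abar : R}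
    (ha : ∀ c, Even c → α c = a) (habar : ∀ c, Odd c → α c = abar) :
    markedSum α p q t (2 * n) h M (IsEWord n)
      = motzkin (fun i => pqBracket p q a (i + 1) * pqBracket p q abar (i + 1))
        (fun i => pqBracket p q 1 (i + 1) * pqBracket p q a (i + 2))
        (fun i => t * pqBracket p q a (i + 1) * pqBracket p q abar (i + 2)) n h := by
  induction n generalizing h with
  | zero => rw [mul_zero, markedSum_isEWord_zero, motzkin]
  | succ n ih =>
    have hMn : 2 * n + 2 < M := by omega
    rw [mul_add, mul_one, markedSum_eq_add (IsTopIn (2 * n + 2)), markedSum_isEWord_top hMn,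
      markedSum_isEWord_not_top hMn, ha (2 * n + 2) (by simp [parity_simps]),
      habar (2 * n + 1) (by simp), ih _ (by omega), ih _ (by omega)]
    cases h with
    | zero =>
      rw [markedSum_valley_zero (by omega), motzkin]
      ring
    | succ h =>
      rw [markedSum_valley (by omega) (dependsOnTypes_isEWord le_rfl), ih _ (by omega), motzkin]
      ring

end EWords

section Positions

variable {m : ℕ}

theorem card_filter_exists_pred (P : Fin m → Fin m → Prop) [DecidableRel P] :
    (Finset.univ.filter fun i : Fin m => ∃ k : Fin m, (k : ℕ) + 1 = i ∧ P k i).card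
      = (Finset.univ.filter fun k : Fin m => ∃ i : Fin m, (k : ℕ) + 1 = i ∧ P k i).card := by
  have himage_snd : (Finset.univ.filter fun i : Fin m => ∃ k : Fin m, (k : ℕ) + 1 = i ∧ P k i)
      = (Finset.univ.filter fun e : Fin m × Fin m => (e.1 : ℕ) + 1 = e.2 ∧ P e.1 e.2).image
        Prod.snd := by
    ext; simp
  have himage_fst : (Finset.univ.filter fun k : Fin m => ∃ i : Fin m, (k : ℕ) + 1 = i ∧ P k i)
      = (Finset.univ.filter fun e : Fin m × Fin m => (e.1 : ℕ) + 1 = e.2 ∧ P e.1 e.2).image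
        Prod.fst := by
    ext; simp
  rw [himage_snd, himage_fst, Finset.card_image_of_injOn, Finset.card_image_of_injOn]
  all_goals
    rintro ⟨k, i⟩ hki ⟨k', i'⟩ hki' h
    have hsucc := ((Finset.mem_filter_univ _).1 hki).1
    have hsucc' := ((Finset.mem_filter_univ _).1 hki').1
    grind

variable {A : Type*}

theorem contextProd_ofFn {R : Type*} [CommMonoid R] (F : List A → A → List A → R) (g : Fin m → A)
    (x y : List A) :
    contextProd F x (List.ofFn g) y
      = ∏ i : Fin m, F (x ++ (List.ofFn g).take i) (g i) ((List.ofFn g).drop (i + 1) ++ y) := by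
  induction m generalizing x with
  | zero => simp [contextProd]
  | succ m ih => simp [contextProd, ih, Fin.prod_univ_succ]

variable (r : A → A → Prop) [DecidableRel r] (f : Fin m → A)

theorem adjCount_ofFn :
    adjCount r (List.ofFn f)
      = (Finset.univ.filter fun j : Fin m =>
          ∃ k : Fin m, (j : ℕ) + 1 = k ∧ r (f j) (f k)).card := by
  induction m with
  | zero => simp [adjCount]
  | succ m ih =>
    cases m with
    | zero => simp [adjCount]
    | succ m =>
      rw [Fin.card_filter_univ_succ', List.ofFn_succ, List.ofFn_succ, adjCount,
        ← List.ofFn_succ (f := fun i => f i.succ), ih]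
      refine congrArg₂ _ (if_congr ?_ rfl rfl) (congrArg _ (Finset.filter_congr fun j _ => ?_))
      · simp [Fin.exists_fin_succ]
      · simp [Fin.exists_fin_succ (n := m + 1)]

theorem adjCount_drop_ofFn (s : ℕ) :
    adjCount r ((List.ofFn f).drop s)
      = (Finset.univ.filter fun j : Fin m =>
          s ≤ j ∧ ∃ k : Fin m, (j : ℕ) + 1 = k ∧ r (f j) (f k)).card := by
  induction m generalizing s with
  | zero => simp [adjCount]
  | succ m ih =>
    cases s with
    | zero => simpa using adjCount_ofFn r f
    | succ s =>
      rw [Fin.card_filter_univ_succ', List.ofFn_succ, List.drop_succ_cons, ih]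
      simp [Fin.exists_fin_succ]

theorem adjCount_take_ofFn (i : Fin m) :
    adjCount r ((List.ofFn f).take i)
      = (Finset.univ.filter fun j : Fin m =>
          j < i ∧ ∃ k : Fin m, (k : ℕ) + 1 = j ∧ r (f k) (f j)).card := by
  have htake : (List.ofFn f).take i = List.ofFn fun j : Fin i => f (j.castLE i.2.le) := by
    refine List.ext_getElem (by simp) fun j _ _ => by simp
  have hcomm (j : Fin m) : (j < i ∧ ∃ k : Fin m, (k : ℕ) + 1 = j ∧ r (f k) (f j))
      ↔ ∃ k : Fin m, (k : ℕ) + 1 = j ∧ j < i ∧ r (f k) (f j) := by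
    simp only [← exists_and_left, and_left_comm]
  rw [htake, adjCount_ofFn]
  simp only [hcomm, card_filter_exists_pred]
  refine Finset.card_nbij (Fin.castLE i.2.le) ?_ (Fin.castLE_injective _).injOn ?_
  · intro j hj
    obtain ⟨k, hjk, hr⟩ := (Finset.mem_filter.1 hj).2
    exact (Finset.mem_filter_univ _).2 ⟨k.castLE i.2.le, hjk, k.2, hr⟩
  · intro j hj
    obtain ⟨k, hjk, hki, hr⟩ := (Finset.mem_filter.1 hj).2
    exact ⟨⟨j, by omega⟩, by simpa using ⟨⟨k, hki⟩, hjk, hr⟩, rfl⟩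

end Positions

section Permutations

/-- The word of the permutation `σ`, followed by the mark `M`. -/
def markedWord {m : ℕ} (M : ℕ) (σ : Equiv.Perm (Fin m)) : List ℕ := List.ofFn (letter σ) ++ [M]

variable {m M : ℕ} {σ : Equiv.Perm (Fin m)}

theorem letter_le (i : Fin m) : letter σ i ≤ m := (σ i).2

theorem letter_injective : Function.Injective (letter σ) := fun _ _ h =>
  σ.injective (Fin.ext (Nat.succ_injective h))

theorem isTopIn_markedWord {c : ℕ} (hc : c ≤ M) :
    IsTopIn c (markedWord M σ) ↔ IsDescentTop σ c := by
  rw [IsTopIn, ← adjCount_eq_zero, markedWord, adjCount_concat fun _ _ => by omega,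
    adjCount_ofFn]
  simp only [Finset.card_eq_zero, Finset.filter_eq_empty_iff]
  grind

theorem isBottomIn_markedWord {c : ℕ} (hc : c < M) :
    IsBottomIn c (markedWord M σ) ↔ IsDescentBottom σ c := by
  rw [IsBottomIn, ← adjCount_eq_zero, markedWord, adjCount_concat fun _ _ => by omega,
    adjCount_ofFn]
  simp only [Finset.card_eq_zero, Finset.filter_eq_empty_iff]
  grind

theorem isEvenOddDescentPerm_iff {n : ℕ} {σ : Equiv.Perm (Fin (2 * n))} :
    IsEvenOddDescentPerm σ ↔
      ∀ j < n, ¬ IsDescentTop σ (2 * j + 1) ∧ ¬ IsDescentBottom σ (2 * j + 2) := by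
  have hletter (i : Fin (2 * n)) : ∃ j < n, letter σ i = 2 * j + 1 ∨ letter σ i = 2 * j + 2 :=
    ⟨σ i / 2, by omega, by rw [letter]; omega⟩
  refine ⟨fun h j _ => ⟨?_, ?_⟩, fun h i k hik => ⟨?_, ?_⟩⟩
  · rintro ⟨i, k, hik, hi⟩
    have heven := (h i k hik).1
    grind
  · rintro ⟨i, k, hik, hk⟩
    have hodd := (h i k hik).2
    grind
  · obtain ⟨j, hj, hij | hij⟩ := hletter i
    · exact absurd ⟨i, k, hik, hij⟩ (h j hj).1
    · exact ⟨j + 1, by omega⟩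
  · obtain ⟨j, hj, hkj | hkj⟩ := hletter k
    · exact ⟨j, hkj⟩
    · exact absurd ⟨i, k, hik, hkj⟩ (h j hj).2

theorem isEWord_markedWord {n : ℕ} {σ : Equiv.Perm (Fin (2 * n))} (hM : 2 * n < M) :
    IsEWord n (markedWord M σ) ↔ IsEPerm σ := by
  have hshift : (∀ j ∈ Finset.Icc 1 n, ¬ (IsDescentBottom σ (2 * j - 1) ∧ IsDescentTop σ (2 * j)))
      ↔ ∀ j < n, ¬ (IsDescentBottom σ (2 * j + 1) ∧ IsDescentTop σ (2 * j + 2)) := by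
    refine ⟨fun h j hj => h (j + 1) (Finset.mem_Icc.2 ⟨by omega, hj⟩), fun h j hj => ?_⟩
    obtain ⟨hj1, hjn⟩ := Finset.mem_Icc.1 hj
    obtain ⟨j, rfl⟩ := Nat.exists_eq_add_of_le' hj1
    exact h j hjn
  rw [IsEPerm, isEvenOddDescentPerm_iff, hshift, ← forall₂_and]
  refine forall₂_congr fun j hj => ?_
  rw [isTopIn_markedWord (by omega), isTopIn_markedWord (by omega),
    isBottomIn_markedWord (by omega), isBottomIn_markedWord (by omega), and_assoc]

theorem markedWord_injective : Function.Injective (markedWord (m := m) M) := fun _ _ h =>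
  Equiv.ext fun i => Fin.ext
    (Nat.succ_injective (congrFun (List.ofFn_injective (List.append_cancel_right h)) i))

theorem isMarkedWord_markedWord (hM : m < M) : IsMarkedWord m 0 M (markedWord M σ) where
  perm := by
    refine List.Perm.append_right _ ((List.perm_ext_iff_of_nodup
      (List.nodup_ofFn.2 letter_injective) List.nodup_range').2 fun c => ?_)
    rw [List.mem_ofFn, List.mem_range'_1]
    refine ⟨?_, fun hc => ⟨σ.symm ⟨c - 1, by omega⟩, by simp [letter, hc.1]⟩⟩
    rintro ⟨i, rfl⟩
    rw [letter]
    omega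
  isSeparated := by
    have hM_notMem : M ∉ List.ofFn (letter σ) := fun hmem => by
      obtain ⟨i, hi⟩ := List.mem_ofFn.1 hmem
      exact ((letter_le i).trans_lt hM).ne hi
    rw [markedWord, isSeparated_concat_mark]
    refine ⟨List.isChain_iff_getElem.2 ?_, fun hlast => hM_notMem (List.mem_of_getLast? hlast)⟩
    exact fun i hi hmark => hM_notMem (hmark.1 ▸ List.getElem_mem _)
  getLast?_eq := by simp [markedWord]

theorem IsMarkedWord.exists_markedWord_eq {w : List ℕ} (hw : IsMarkedWord m 0 M w) :
    ∃ σ : Equiv.Perm (Fin m), markedWord M σ = w := by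
  obtain ⟨z, rfl⟩ := List.getLast?_eq_some_iff.1 hw.getLast?_eq
  have hz : z.Perm (List.range' 1 m) := (List.perm_append_right_iff [M]).1 hw.perm
  have hlength : z.length = m := by simpa using hz.length_eq
  subst hlength
  have hmem (i : Fin z.length) : 1 ≤ z[i] ∧ z[i] < 1 + z.length :=
    List.mem_range'_1.1 (hz.mem_iff.1 (List.getElem_mem i.2))
  let f (i : Fin z.length) : Fin z.length := ⟨z[i] - 1, by have := hmem i; omega⟩
  have hf : Function.Injective f := by
    intro i j hij
    have hi := hmem i
    have hj := hmem j
    have hpred : z[i] - 1 = z[j] - 1 := Fin.ext_iff.1 hij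
    have hget : z[i] = z[j] := by omega
    exact (hz.nodup_iff.2 List.nodup_range').injective_get hget
  refine ⟨Equiv.ofBijective f (Finite.injective_iff_bijective.1 hf), ?_⟩
  rw [markedWord, List.append_cancel_right_eq]
  refine List.ext_getElem (by simp) fun i hi hi' => ?_
  have := hmem ⟨i, hi'⟩
  simp only [List.getElem_ofFn, letter, Equiv.ofBijective_apply, f]
  grind

theorem sum_straddle_drop_eq_res (σ : Equiv.Perm (Fin m)) :
    ∑ i : Fin m, straddle (letter σ i) ((List.ofFn (letter σ)).drop (i + 1)) = res σ := by
  simp only [straddle, adjCount_drop_ofFn, res, Finset.card_filter, Fintype.sum_prod_type]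
  refine Finset.sum_congr rfl fun i _ => Finset.sum_congr rfl fun j _ => if_congr ?_ rfl rfl
  grind

theorem sum_straddle_take_eq_les (σ : Equiv.Perm (Fin m)) :
    ∑ i : Fin m, straddle (letter σ i) ((List.ofFn (letter σ)).take i) = les σ := by
  simp only [straddle, adjCount_take_ofFn, les, Finset.card_filter, Fintype.sum_prod_type_right]
  refine Finset.sum_congr rfl fun i _ => Finset.sum_congr rfl fun j _ => if_congr ?_ rfl rfl
  grind

theorem isLRMax_iff_forall_mem_take {i : Fin m} :
    IsLRMax σ i ↔ ∀ c ∈ (List.ofFn (letter σ)).take i, c < letter σ i := by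
  simp only [List.forall_mem_iff_forall_getElem, List.getElem_take, List.getElem_ofFn,
    List.length_take, List.length_ofFn]
  exact ⟨fun h j hj => h ⟨j, by omega⟩ (by grind), fun h j hj => h j (by grind)⟩

theorem exists_isDescentAt_iff_head? (hM : m ≤ M) {i : Fin m} :
    (∃ j, IsDescentAt σ i j) ↔
      ∃ b ∈ ((List.ofFn (letter σ)).drop (i + 1) ++ [M]).head?, b < letter σ i := by
  rw [List.head?_append, List.head?_drop]
  by_cases hi : (i : ℕ) + 1 < m
  · rw [List.getElem?_eq_getElem (by simpa using hi)]
    simp only [List.getElem_ofFn, Option.some_or, Option.mem_some_iff, exists_eq_left']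
    exact ⟨fun ⟨j, hij, _⟩ => by grind, fun hlt => ⟨⟨i + 1, hi⟩, rfl, hlt⟩⟩
  · have hletter : ¬ M < letter σ i := ((letter_le i).trans hM).not_gt
    have hnone : (List.ofFn (letter σ))[(i : ℕ) + 1]? = none := by simpa using hi
    simp only [hnone, Option.none_or, List.head?_singleton, Option.mem_some_iff, exists_eq_left',
      hletter, iff_false]
    rintro ⟨j, hij, -⟩
    omega

section PermutationWeight

variable {R : Type*} [CommMonoid R] {a abar p q t : R}

theorem prod_ite_isLRMax (σ : Equiv.Perm (Fin m)) (a abar : R) :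
    ∏ i, (if IsLRMax σ i then if Even (letter σ i) then a else abar else 1)
      = a ^ lema σ * abar ^ loma σ := by
  simp only [lema, loma, ← Finset.prod_const, Finset.prod_filter, ← Finset.prod_mul_distrib]
  refine Finset.prod_congr rfl fun i _ => ?_
  by_cases hmax : IsLRMax σ i <;> by_cases heven : Even (letter σ i) <;>
    simp [hmax, heven, ← Nat.not_even_iff_odd]

theorem wordWeight_markedWord (hM : m < M) :
    wordWeight (fun c => if Even c then a else abar) p q t M (markedWord M σ)
      = a ^ lema σ * abar ^ loma σ * p ^ res σ * q ^ les σ * t ^ des σ := by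
  have hletter (i : Fin m) : letter σ i ≠ M := ((letter_le i).trans_lt hM).ne
  have hright (i : Fin m) :
      straddle (letter σ i) ((List.ofFn (letter σ)).drop (i + 1) ++ [M])
        = straddle (letter σ i) ((List.ofFn (letter σ)).drop (i + 1)) :=
    adjCount_concat fun _ _ hlt => hlt.1.not_ge ((letter_le i).trans hM.le)
  have hdes : ∏ i, (if ∃ j, IsDescentAt σ i j then t else 1) = t ^ des σ := by
    rw [des, ← Finset.prod_const, Finset.prod_filter]
  rw [wordWeight, markedWord, contextProd_append, contextProd_ofFn, ← prod_ite_isLRMax,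
    ← sum_straddle_drop_eq_res, ← sum_straddle_take_eq_les, ← hdes]
  simp only [← Finset.prod_pow_eq_pow_sum, ← Finset.prod_mul_distrib]
  simp only [contextProd, mul_one, letterWeight, if_true, List.nil_append, List.append_nil, hletter,
    if_false, hright, ← isLRMax_iff_forall_mem_take,
    ← exists_isDescentAt_iff_head? hM.le]

end PermutationWeight

theorem ePoly_eq_markedSum {R : Type*} [CommRing R] (a abar p q t : R) (n : ℕ) :
    ePoly a abar p q t n = markedSum (fun c => if Even c then a else abar) p q t (2 * n) 0
      (2 * n + 1) (IsEWord n) := by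
  refine Finset.sum_nbij (markedWord (2 * n + 1)) ?_ markedWord_injective.injOn ?_ ?_
  · intro σ hσ
    rw [mem_markedWords, isEWord_markedWord (by omega)]
    exact ⟨isMarkedWord_markedWord (by omega), (Finset.mem_filter.1 hσ).2⟩
  · intro w hw
    obtain ⟨hw, hE⟩ := mem_markedWords.1 hw
    obtain ⟨σ, rfl⟩ := hw.exists_markedWord_eq
    rw [isEWord_markedWord (by omega)] at hE
    exact ⟨σ, by simpa using hE, rfl⟩
  · exact fun σ _ => (wordWeight_markedWord (by omega)).symm

end Permutations

end EPermJFrac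

theorem mainTheorem9 {R : Type*} [CommRing R] (a abar p q t : R) :
    EPermJFrac.IsJFraction
      (PowerSeries.mk fun n => if n = 0 then 1 else EPermJFrac.ePoly a abar p q t n)
      (fun n => EPermJFrac.pqBracket p q a (n + 1) * EPermJFrac.pqBracket p q abar (n + 1))
      (fun n => t * EPermJFrac.pqBracket p q a n * EPermJFrac.pqBracket p q a (n + 1)
        * EPermJFrac.pqBracket p q 1 n * EPermJFrac.pqBracket p q abar (n + 1)) := by
  refine EPermJFrac.isJFraction_of_coeff_eq_motzkin
    (up := fun h => EPermJFrac.pqBracket p q 1 (h + 1) * EPermJFrac.pqBracket p q a (h + 2))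
    (down := fun h =>
      t * EPermJFrac.pqBracket p q a (h + 1) * EPermJFrac.pqBracket p q abar (h + 2))
    (fun h => by ring) fun n => ?_
  rw [PowerSeries.coeff_mk]
  split_ifs with hn
  · rw [hn, EPermJFrac.motzkin, if_pos rfl]
  · rw [EPermJFrac.ePoly_eq_markedSum]
    exact EPermJFrac.markedSum_isEWord_eq_motzkin n 0 (Nat.lt_succ_self _)
      (fun c hc => if_pos hc) fun c hc => if_neg (Nat.not_even_iff_odd.2 hc)
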